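/- Let $(\beta_n)_{n\ge0}$ and $(\hat\beta_n)_{n\ge0}$ be real sequences and let the monic polynomials $b_n$ be given by $b_{-1}=0$, $b_0=1$, $b_{n+1}(x)=(x-\beta_n)b_n(x)-\hat\beta_{n-1}b_{n-1}(x)$. Let $B$ be a probability measure on $\mathbb R$ with respect to which $(b_n)_{n\ge 0}$ is orthogonal (all $\int b_mb_n\,dB$ exist, they vanish for $m\ne n$, and $\int b_n^2\,dB>0$). Let $C,D$ be real numbers with $B(\{-D\})=0$ and $\frac{C}{x+D}\ge 0$ on $\operatorname{supp}B\setminus\{-D\}$, and suppose that $dA(x)=\frac{C}{x+D}\,dB(x)$ is a probability measure. Put $\kappa_1=\beta_0+D-C$ and $\kappa_n=\beta_{n-1}-\frac{\hat\beta_{n-2}}{\kappa_{n-1}}+D$ for $n\ge2$, and $a_0=1$, $a_n=b_n+\kappa_nb_{n-1}$ for $n\ge1$. Then: (i) $\kappa_n\ne0$ for all $n\ge1$, the monic polynomials $(a_n)_{n\ge 0}$ are orthogonal with respect to $A$, and for $n=0,1,2,\dots$ $$b_n(x)=a_n(x)+\sum_{j=1}^{n}(-1)^j\Big(\prod_{k=n-j+1}^{n}\kappa_k\Big)a_{n-j}(x).$$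 (ii) Suppose in addition that $B$ is the only probability measure with respect to which $(b_n)$ is orthogonal, and that $\int\frac{1}{(x+D)^2}\,dB(x)<\infty$. Then $$\frac{C}{x+D}=1+\sum_{n\ge1}(-1)^n\Big(\prod_{k=1}^{n}\frac{\kappa_k}{\hat\beta_{k-1}}\Big)b_n(x)\quad\text{in }L_2(dB),\qquad 1+\sum_{n\ge1}\prod_{k=1}^{n}\frac{\kappa_k^2}{\hat\beta_{k-1}}=C^2\int\frac{1}{(x+D)^2}\,dB(x).$$ (iii) If, in addition to the assumptions of (ii), $\sum_{n\ge1}\Big(\prod_{k=1}^{n}\frac{\kappa_k^2}{\hat\beta_{k-1}}\Big)\log^2n<\infty$, then the series in (ii) converges to $\frac{C}{x+D}$ for $B$-almost every $x$. -/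

import Mathlib

open MeasureTheory Filter Topology

noncomputable section

/-- A sequence of monic polynomials, `p n` of degree `n`, that is orthogonal with respect to the
(positive) measure `μ`: all products are integrable, distinct members are orthogonal, and no member
has norm zero. -/
structure IsMonicOrthogonal (μ : Measure ℝ) (p : ℕ → Polynomial ℝ) : Prop where
  monic : ∀ n, (p n).Monic
  natDegree_eq : ∀ n, (p n).natDegree = n
  integrable : ∀ m n, Integrable (fun x => (p m).eval x * (p n).eval x) μ
  orthogonal : ∀ m n, m ≠ n → ∫ x, (p m).eval x * (p n).eval x ∂μ = 0
  norm_pos : ∀ n, 0 < ∫ x, (p n).eval x ^ 2 ∂μ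

/-- The polynomials given by the 3-term recurrence
`b (n + 1) = (x - β n) b n - γ (n - 1) b (n - 1)`, `b 0 = 1`, `b (-1) = 0`;
here `γ` is the sequence written `β̂` in the mathematics. -/
def bPoly (β γ : ℕ → ℝ) : ℕ → Polynomial ℝ
  | 0 => 1
  | 1 => Polynomial.X - Polynomial.C (β 0)
  | n + 2 => (Polynomial.X - Polynomial.C (β (n + 1))) * bPoly β γ (n + 1)
      - Polynomial.C (γ n) * bPoly β γ n

/-- `κ 1 = β 0 + D - C` and `κ n = β (n - 1) - γ (n - 2) / κ (n - 1) + D` for `n ≥ 2`.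
The value at `0` is never used. -/
def kappa (β γ : ℕ → ℝ) (C D : ℝ) : ℕ → ℝ
  | 0 => 1
  | 1 => β 0 + D - C
  | n + 2 => β (n + 1) - γ n / kappa β γ C D (n + 1) + D

/-- `a n = b n + κ n * b (n - 1)`, with `b (-1) = 0`. -/
def aPoly (β γ : ℕ → ℝ) (C D : ℝ) : ℕ → Polynomial ℝ
  | 0 => bPoly β γ 0
  | n + 1 => bPoly β γ (n + 1) + Polynomial.C (kappa β γ C D (n + 1)) * bPoly β γ n

/-- The partial sum
`1 + ∑_{n = 1}^{N} (-1)^n (∏_{k = 1}^{n} κ k / γ (k - 1)) b n (x)`. -/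
def partialSum (β γ : ℕ → ℝ) (C D : ℝ) (N : ℕ) (x : ℝ) : ℝ :=
  1 + ∑ n ∈ Finset.Icc 1 N,
    (-1) ^ n * (∏ k ∈ Finset.Icc 1 n, kappa β γ C D k / γ (k - 1)) * (bPoly β γ n).eval x

/-- The squared `L²` norm of the `n`-th term of the series: `∏_{k = 1}^{n} κ k ^ 2 / γ (k - 1)`
(the squared norm of `b n` is `∏_{k = 1}^{n} γ (k - 1)`). It equals `1` for `n = 0`. -/
def energy (β γ : ℕ → ℝ) (C D : ℝ) (n : ℕ) : ℝ :=
  ∏ k ∈ Finset.Icc 1 n, kappa β γ C D k ^ 2 / γ (k - 1)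

end

/-! Put w = C/(x + D). Since (x + D) dA = C dB, and every polynomial is q = (x + D) r + q(-D),
integrals against A reduce to integrals against B and the values at -D. Applied to b_n², this shows
that m_n = ∫ b_n dA cannot vanish; applied to the recurrence, it gives m_{n+1} = -κ_{n+1} m_n. So
a_{n+1} = b_{n+1} + κ_{n+1} b_n is a combination that A annihilates, and together with the
orthogonality under B this makes it orthogonal under A to all lower degrees.

Also m_n = ∫ w b_n dB, while ∫ b_n² dB is the product of the γ's. Hence the series in (ii) is the
Fourier series of w in (b_n), and (ii) says that w lies in the L² closure of the polynomials
(`exists_polynomial_integral_sub_sq_lt`). Suppose instead that its squared distance from them is at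
least ε > 0. Then q ↦ ∫ q w² dB - ε q(-D) is nonnegative on squares, so by `hamburger` it comes from
a measure σ. The measure (x + D)²/C² dσ has the moments of B, hence equals B by determinacy.
Integrating w² against it gives ∫ w² dB ≤ σ(ℝ) = ∫ w² dB - ε, a contradiction.

Part (iii) is `rademacher_menshov` applied to this Fourier series. -/

/-! ### Nonnegative polynomials and sums of squares -/

/-- A real polynomial that is nonnegative on the real line is a sum of squares. -/
theorem Polynomial.isSumSq_of_eval_nonneg (p : Polynomial ℝ) (hp : ∀ x, 0 ≤ p.eval x) :
    IsSumSq p := by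
  induction hn : p.natDegree using Nat.strong_induction_on generalizing p with
  | _ n ih =>
  by_cases hn0 : n = 0
  · obtain ⟨a, rfl⟩ := Polynomial.natDegree_eq_zero.1 (hn.trans hn0)
    have ha : 0 ≤ a := by simpa using hp 0
    have : (Polynomial.C a : Polynomial ℝ)
        = Polynomial.C (Real.sqrt a) * Polynomial.C (Real.sqrt a) := by
      rw [← Polynomial.C_mul, Real.mul_self_sqrt ha]
    rw [this]
    exact IsSumSq.mul_self _
  have hp0 : p ≠ 0 := by
    rintro rfl
    exact hn0 (by simpa using hn.symm)
  obtain ⟨z, hz⟩ := IsAlgClosed.exists_aeval_eq_zero ℂ p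
    (fun h => hn0 (by rw [← hn, Polynomial.natDegree_eq_zero_iff_degree_le_zero, h]))
  by_cases him : z.im = 0
  · obtain ⟨r, rfl⟩ : ∃ r : ℝ, (r : ℂ) = z := ⟨z.re, Complex.ext rfl him.symm⟩
    have hr : p.IsRoot r := by
      have : ((p.eval r : ℝ) : ℂ) = 0 := by
        rw [← hz]
        exact (Polynomial.aeval_algebraMap_apply_eq_algebraMap_eval (A := ℂ) r p).symm
      exact_mod_cast this
    obtain ⟨q, rfl⟩ := Polynomial.dvd_iff_isRoot.2 hr
    -- A real root is a minimum of `p`, so the derivative vanishes there and the root is at least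
    -- double.
    have hmin : IsLocalMin (fun x => ((Polynomial.X - Polynomial.C r) * q).eval x) r :=
      Eventually.of_forall fun x => by simpa using hp x
    have hder := hmin.hasDerivAt_eq_zero (Polynomial.hasDerivAt _ r)
    have hq : q.IsRoot r := by simpa using hder
    obtain ⟨s, rfl⟩ := Polynomial.dvd_iff_isRoot.2 hq
    have hs : ∀ x, 0 ≤ s.eval x := by
      have hcl : IsClosed {x : ℝ | 0 ≤ s.eval x} := isClosed_le continuous_const s.continuous
      have hsub : ({r}ᶜ : Set ℝ) ⊆ {x : ℝ | 0 ≤ s.eval x} := by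
        intro x hx
        have h1 := hp x
        have h2 : 0 < (x - r) ^ 2 := by
          have : x - r ≠ 0 := sub_ne_zero.2 hx
          positivity
        have h3 : 0 ≤ (x - r) ^ 2 * s.eval x := by
          simp at h1
          linarith
        exact nonneg_of_mul_nonneg_right h3 h2
      intro x
      exact hcl.closure_subset_iff.2 hsub ((dense_compl_singleton r) x)
    have hs0 : s ≠ 0 := by
      rintro rfl
      simp at hp0
    have hX : (Polynomial.X - Polynomial.C r : Polynomial ℝ) ≠ 0 := Polynomial.X_sub_C_ne_zero r
    have hdeg : s.natDegree < n := by
      rw [← hn, Polynomial.natDegree_mul hX (mul_ne_zero hX hs0), Polynomial.natDegree_mul hX hs0,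
        Polynomial.natDegree_X_sub_C]
      omega
    rw [← mul_assoc]
    exact (IsSumSq.mul_self _).mul (ih _ hdeg s hs rfl)
  · obtain ⟨q, hq⟩ := Polynomial.quadratic_dvd_of_aeval_eq_zero_im_ne_zero p hz him
    set Q : Polynomial ℝ :=
      Polynomial.X ^ 2 - Polynomial.C (2 * z.re) * Polynomial.X + Polynomial.C (‖z‖ ^ 2) with hQ
    -- The factor of a conjugate pair of roots is (x - Re z)² + (Im z)², a strictly positive sum of
    -- two squares.
    have hQs : Q = (Polynomial.X - Polynomial.C z.re) * (Polynomial.X - Polynomial.C z.re)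
        + Polynomial.C z.im * Polynomial.C z.im := by
      rw [hQ, ← Complex.normSq_eq_norm_sq, Complex.normSq_apply]
      simp only [Polynomial.C_add, Polynomial.C_mul, Polynomial.C_ofNat]
      ring
    have hQpos : ∀ x, 0 < Q.eval x := by
      intro x
      have : 0 < z.im * z.im := mul_self_pos.2 him
      simp only [hQs, Polynomial.eval_add, Polynomial.eval_mul, Polynomial.eval_sub,
        Polynomial.eval_X, Polynomial.eval_C]
      nlinarith [mul_self_nonneg (x - z.re)]
    have hqn : ∀ x, 0 ≤ q.eval x := by
      intro x
      have := hp x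
      rw [hq, Polynomial.eval_mul] at this
      exact nonneg_of_mul_nonneg_right this (hQpos x)
    have hQ2 : Q.natDegree = 2 := by
      rw [hQ]
      compute_degree!
    have hq0 : q ≠ 0 := by
      rintro rfl
      exact hp0 (by rw [hq, mul_zero])
    have hQ0 : Q ≠ 0 := by
      intro h
      simp [h] at hQ2
    have hdeg : q.natDegree < n := by
      rw [← hn, hq, Polynomial.natDegree_mul hQ0 hq0, hQ2]
      omega
    have hQsum : IsSumSq Q := hQs ▸ (IsSumSq.mul_self _).add (IsSumSq.mul_self _)
    rw [hq]
    exact hQsum.mul (ih _ hdeg q hqn rfl)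

/-- A linear functional that is nonnegative on squares is nonnegative on the polynomials that are
nonnegative on the real line. -/
theorem Polynomial.functional_nonneg_of_eval_nonneg (L : Polynomial ℝ →ₗ[ℝ] ℝ)
    (hL : ∀ p, 0 ≤ L (p * p)) (p : Polynomial ℝ) (hp : ∀ x, 0 ≤ p.eval x) : 0 ≤ L p := by
  have hs := Polynomial.isSumSq_of_eval_nonneg p hp
  clear hp
  induction hs with
  | zero => simp
  | sq_add a _ hs =>
    rw [map_add]
    exact add_nonneg (hL a) hs

/-! ### Positive extension and Hamburger's theorem -/

/-- The functions `ℝ → ℝ` whose absolute value is bounded by a polynomial. -/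
def polynomiallyBounded : Submodule ℝ (ℝ → ℝ) where
  carrier := {f | ∃ p : Polynomial ℝ, ∀ x, |f x| ≤ p.eval x}
  add_mem' := by
    rintro f g ⟨p, hp⟩ ⟨q, hq⟩
    refine ⟨p + q, fun x => ?_⟩
    rw [Polynomial.eval_add]
    exact (abs_add_le _ _).trans (add_le_add (hp x) (hq x))
  zero_mem' := ⟨0, fun x => by simp⟩
  smul_mem' := by
    rintro c f ⟨p, hp⟩
    refine ⟨Polynomial.C |c| * p, fun x => ?_⟩
    simp only [Pi.smul_apply, smul_eq_mul, abs_mul, Polynomial.eval_mul, Polynomial.eval_C]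
    exact mul_le_mul_of_nonneg_left (hp x) (abs_nonneg c)

theorem abs_eval_le_eval_one_add_sq (p : Polynomial ℝ) (x : ℝ) :
    |p.eval x| ≤ (1 + p * p).eval x := by
  simp only [Polynomial.eval_add, Polynomial.eval_one, Polynomial.eval_mul]
  nlinarith [sq_abs (p.eval x), sq_nonneg (|p.eval x| - 1), abs_nonneg (p.eval x)]

theorem eval_mem_polynomiallyBounded (p : Polynomial ℝ) :
    (fun x => p.eval x) ∈ polynomiallyBounded :=
  ⟨1 + p * p, abs_eval_le_eval_one_add_sq p⟩

/-- Evaluation of polynomials, as a map into the polynomially bounded functions. -/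
def polynomialToFunction : Polynomial ℝ →ₗ[ℝ] polynomiallyBounded where
  toFun p := ⟨fun x => p.eval x, eval_mem_polynomiallyBounded p⟩
  map_add' p q := by
    ext x
    simp
  map_smul' c p := by
    ext x
    simp

theorem polynomialToFunction_injective : Function.Injective polynomialToFunction := by
  intro p q h
  exact Polynomial.funext fun x => congrFun (congrArg Subtype.val h) x

/-- A functional on polynomials that is nonnegative on squares extends to a positive functional on
the polynomially bounded functions. -/
theorem exists_positive_extension (L : Polynomial ℝ →ₗ[ℝ] ℝ) (hL : ∀ p, 0 ≤ L (p * p)) :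
    ∃ Λ : polynomiallyBounded →ₗ[ℝ] ℝ, (∀ p, Λ (polynomialToFunction p) = L p) ∧
      ∀ f : polynomiallyBounded, (∀ x, 0 ≤ (f : ℝ → ℝ) x) → 0 ≤ Λ f := by
  let e := LinearEquiv.ofInjective polynomialToFunction polynomialToFunction_injective
  let f : polynomiallyBounded →ₗ.[ℝ] ℝ := ⟨LinearMap.range polynomialToFunction, L ∘ₗ e.symm⟩
  let s : PointedCone ℝ polynomiallyBounded :=
    { carrier := {f | ∀ x, 0 ≤ (f : ℝ → ℝ) x}
      add_mem' := fun ha hb x => add_nonneg (ha x) (hb x)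
      zero_mem' := fun x => le_rfl
      smul_mem' := fun c _ hg x => mul_nonneg c.2 (hg x) }
  have hf : ∀ p, f (e p) = L p := fun p => congrArg L (e.symm_apply_apply p)
  obtain ⟨Λ, h1, h2⟩ := riesz_extension s f (by
      intro y hy
      obtain ⟨p, rfl⟩ := e.surjective y
      rw [hf]
      exact Polynomial.functional_nonneg_of_eval_nonneg L hL p hy) (by
      -- The Riesz condition is where polynomial bounds enter: |g| ≤ p gives p + g ≥ 0.
      rintro ⟨g, p, hp⟩
      refine ⟨e p, fun x => ?_⟩
      have := (abs_le.1 (hp x)).1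
      change 0 ≤ p.eval x + g x
      linarith)
  exact ⟨Λ, fun p => (h1 (e p)).trans (hf p), h2⟩

/-- The continuous cutoff function that is `1` on `[-n, n]` and `0` outside `[-n - 1, n + 1]`. -/
def cutoff (n : ℕ) (x : ℝ) : ℝ := max 0 (min 1 (n + 1 - |x|))

theorem cutoff_nonneg (n : ℕ) (x : ℝ) : 0 ≤ cutoff n x := le_max_left _ _

theorem cutoff_le_one (n : ℕ) (x : ℝ) : cutoff n x ≤ 1 :=
  max_le zero_le_one (min_le_left _ _)

theorem cutoff_eq_one {n : ℕ} {x : ℝ} (h : |x| ≤ n) : cutoff n x = 1 := by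
  rw [cutoff, min_eq_left (by linarith), max_eq_right zero_le_one]

theorem continuous_cutoff (n : ℕ) : Continuous (cutoff n) := by
  unfold cutoff
  fun_prop

theorem hasCompactSupport_cutoff (n : ℕ) : HasCompactSupport (cutoff n) := by
  refine HasCompactSupport.intro (isCompact_Icc (a := -(n + 1 : ℝ)) (b := n + 1)) fun x hx => ?_
  have : (n + 1 : ℝ) < |x| := by
    by_contra! h
    exact hx (abs_le.1 h)
  rw [cutoff, max_eq_left]
  exact (min_le_right _ _).trans (by linarith)

theorem tendsto_cutoff (x : ℝ) : Tendsto (fun n => cutoff n x) atTop (𝓝 1) := by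
  refine tendsto_const_nhds.congr' ?_
  filter_upwards [eventually_ge_atTop ⌈|x|⌉₊] with n hn
  exact (cutoff_eq_one ((Nat.le_ceil _).trans (by exact_mod_cast hn))).symm

/-- A polynomial multiplied by a cutoff function. -/
def cutoffMul (n : ℕ) (p : Polynomial ℝ) : CompactlySupportedContinuousMap ℝ ℝ where
  toFun x := cutoff n x * p.eval x
  continuous_toFun := (continuous_cutoff n).mul p.continuous
  hasCompactSupport' := (hasCompactSupport_cutoff n).mul_right

theorem CompactlySupportedContinuousMap.mem_polynomiallyBounded
    (f : CompactlySupportedContinuousMap ℝ ℝ) : (f : ℝ → ℝ) ∈ polynomiallyBounded := by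
  obtain ⟨K, hK⟩ := f.hasCompactSupport'.exists_bound_of_continuous f.continuous_toFun
  exact ⟨Polynomial.C K, fun x => by simpa using hK x⟩

/-- The inclusion of the compactly supported functions into the polynomially bounded ones. -/
def compactlySupportedToBounded :
    CompactlySupportedContinuousMap ℝ ℝ →ₗ[ℝ] polynomiallyBounded where
  toFun f := ⟨f, f.mem_polynomiallyBounded⟩
  map_add' _ _ := rfl
  map_smul' _ _ := rfl

/-- **Hamburger's theorem**: a functional on polynomials that is nonnegative on squares is given by
a positive measure on the real line. -/
theorem hamburger (L : Polynomial ℝ →ₗ[ℝ] ℝ) (hL : ∀ p, 0 ≤ L (p * p)) :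
    ∃ μ : Measure ℝ, ∀ p : Polynomial ℝ,
      Integrable (fun x => p.eval x) μ ∧ ∫ x, p.eval x ∂μ = L p := by
  obtain ⟨Λ, hΛ, hpos⟩ := exists_positive_extension L hL
  have hmono : ∀ f g : polynomiallyBounded, (∀ x, (f : ℝ → ℝ) x ≤ (g : ℝ → ℝ) x) → Λ f ≤ Λ g := by
    intro f g h
    have := hpos (g - f) (fun x => sub_nonneg.2 (h x))
    rw [map_sub] at this
    linarith
  let Φ : CompactlySupportedContinuousMap ℝ ℝ →ₚ[ℝ] ℝ :=
    PositiveLinearMap.mk₀ (Λ ∘ₗ compactlySupportedToBounded) (fun f hf => hpos _ hf)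
  let μ := RealRMK.rieszMeasure Φ
  have hμ : ∀ (n : ℕ) (p : Polynomial ℝ), ∫ x, cutoff n x * p.eval x ∂μ = Λ (compactlySupportedToBounded (cutoffMul n p)) :=
    fun n p => RealRMK.integral_rieszMeasure Φ (cutoffMul n p)
  have hint : ∀ (n : ℕ) (p : Polynomial ℝ), Integrable (fun x => cutoff n x * p.eval x) μ := fun n p =>
    Continuous.integrable_of_hasCompactSupport (cutoffMul n p).continuous_toFun
      (cutoffMul n p).hasCompactSupport'
  have hnonneg : ∀ p : Polynomial ℝ, (∀ x, 0 ≤ p.eval x) → Integrable (fun x => p.eval x) μ := by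
    intro p hp
    -- Fatou: by positivity of `Λ`, the integrals of the truncations never exceed `L p`.
    refine integrable_of_tendsto (G := fun n x => cutoff n x * p.eval x) (.of_forall fun x => ?_)
      (fun n => (hint n p).aestronglyMeasurable) (ne_top_of_le_ne_top ENNReal.ofReal_ne_top
        (liminf_le_of_frequently_le' (.of_forall fun n => ?_) : _ ≤ ENNReal.ofReal (L p)))
    · simpa using (tendsto_cutoff x).mul_const (p.eval x)
    · rw [← ofReal_integral_norm_eq_lintegral_enorm (hint n p)]
      refine ENNReal.ofReal_le_ofReal ?_
      calc ∫ x, ‖cutoff n x * p.eval x‖ ∂μ = ∫ x, cutoff n x * p.eval x ∂μ :=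
            integral_congr_ae (.of_forall fun x =>
              Real.norm_of_nonneg (mul_nonneg (cutoff_nonneg n x) (hp x)))
        _ ≤ L p := by
            rw [hμ, ← hΛ]
            exact hmono _ _ fun x => mul_le_of_le_one_left (hp x) (cutoff_le_one n x)
  have hI : ∀ p : Polynomial ℝ, Integrable (fun x => p.eval x) μ := by
    intro p
    refine (hnonneg (1 + p * p) fun x => ?_).mono' p.continuous.aestronglyMeasurable ?_
    · exact (abs_nonneg _).trans (abs_eval_le_eval_one_add_sq p x)
    · exact Eventually.of_forall (abs_eval_le_eval_one_add_sq p)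
  refine ⟨μ, fun p => ⟨hI p, ?_⟩⟩
  have h1 : Tendsto (fun n : ℕ => ∫ x, cutoff n x * p.eval x ∂μ) atTop (𝓝 (∫ x, p.eval x ∂μ)) := by
    refine tendsto_integral_of_dominated_convergence (fun x => |p.eval x|)
      (fun n => (hint n p).aestronglyMeasurable) (hI p).abs (fun n => ?_) ?_
    · refine Eventually.of_forall fun x => ?_
      rw [Real.norm_eq_abs, abs_mul, abs_of_nonneg (cutoff_nonneg n x)]
      exact mul_le_of_le_one_left (abs_nonneg _) (cutoff_le_one n x)
    · refine Eventually.of_forall fun x => ?_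
      simpa using (tendsto_cutoff x).mul_const (p.eval x)
  -- The truncation error lives on |x| ≥ n, where |p| ≤ |x p|/n ≤ r/n. The factor 1/n lets
  -- positivity of `Λ` replace continuity: it bounds the error by `L r / n`.
  let r : Polynomial ℝ := 1 + (Polynomial.X * p) * (Polynomial.X * p)
  have hbound : ∀ n : ℕ, 0 < n → ∀ x, (1 - cutoff n x) * |p.eval x| ≤ (1 / n : ℝ) * r.eval x := by
    intro n hn x
    have hn' : (0 : ℝ) < n := by exact_mod_cast hn
    have hr : |x * p.eval x| ≤ r.eval x := by
      have := abs_eval_le_eval_one_add_sq (Polynomial.X * p) x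
      rwa [Polynomial.eval_mul, Polynomial.eval_X] at this
    rw [abs_mul] at hr
    rcases le_total |x| n with h | h
    · rw [cutoff_eq_one h, sub_self, zero_mul]
      exact mul_nonneg (by positivity) ((by positivity : (0 : ℝ) ≤ |x| * |p.eval x|).trans hr)
    · rw [one_div, inv_mul_eq_div, le_div_iff₀ hn']
      have h2 := cutoff_nonneg n x
      have h3 := cutoff_le_one n x
      calc (1 - cutoff n x) * |p.eval x| * n ≤ 1 * |p.eval x| * |x| := by
            gcongr
            linarith
        _ ≤ r.eval x := by linarith
  have h2 : Tendsto (fun n : ℕ => ∫ x, cutoff n x * p.eval x ∂μ) atTop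
      (𝓝 (L p)) := by
    rw [tendsto_iff_dist_tendsto_zero]
    have hlim : Tendsto (fun n : ℕ => (1 / n : ℝ) * L r) atTop (𝓝 0) := by
      simpa using tendsto_one_div_atTop_nhds_zero_nat.mul_const (L r)
    refine squeeze_zero' (Eventually.of_forall fun _ => dist_nonneg) ?_ hlim
    filter_upwards [eventually_gt_atTop 0] with n hn
    have e1 : (1 / n : ℝ) * L r = Λ ((1 / n : ℝ) • polynomialToFunction r) := by
      rw [map_smul, hΛ, smul_eq_mul]
    rw [hμ, ← hΛ p, Real.dist_eq, ← map_sub, e1, abs_le, ← map_neg]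
    have hb := hbound n hn
    constructor
    all_goals
      refine hmono _ _ fun x => ?_
      have h3 := hb x
      have h4 : (1 - cutoff n x) * p.eval x ≤ (1 - cutoff n x) * |p.eval x| :=
        mul_le_mul_of_nonneg_left (le_abs_self _) (by linarith [cutoff_le_one n x])
      have h5 : (1 - cutoff n x) * -p.eval x ≤ (1 - cutoff n x) * |p.eval x| :=
        mul_le_mul_of_nonneg_left (neg_le_abs _) (by linarith [cutoff_le_one n x])
    · change -((1 / n : ℝ) * r.eval x) ≤ cutoff n x * p.eval x - p.eval x
      linarith
    · change cutoff n x * p.eval x - p.eval x ≤ (1 / n : ℝ) * r.eval x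
      linarith
  exact tendsto_nhds_unique h1 h2

/-! ### Orthogonal series and the Rademacher–Menshov theorem -/

section Orthogonal

variable {α : Type*} [MeasurableSpace α] {μ : Measure α} {φ : ℕ → α → ℝ}

theorem integrable_sq_sum (hint : ∀ m n, Integrable (fun x => φ m x * φ n x) μ) (s : Finset ℕ) :
    Integrable (fun x => (∑ i ∈ s, φ i x) ^ 2) μ := by
  simp only [sq, Finset.sum_mul_sum]
  exact integrable_finsetSum _ fun i _ => integrable_finsetSum _ fun j _ => hint i j

theorem integral_sq_sum (hint : ∀ m n, Integrable (fun x => φ m x * φ n x) μ)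
    (horth : ∀ m n, m ≠ n → ∫ x, φ m x * φ n x ∂μ = 0) (s : Finset ℕ) :
    ∫ x, (∑ i ∈ s, φ i x) ^ 2 ∂μ = ∑ i ∈ s, ∫ x, φ i x ^ 2 ∂μ := by
  simp only [sq, Finset.sum_mul_sum]
  rw [integral_finsetSum _ fun i _ => integrable_finsetSum _ fun j _ => hint i j]
  refine Finset.sum_congr rfl fun i hi => ?_
  rw [integral_finsetSum _ fun j _ => hint i j, Finset.sum_eq_single i]
  · exact fun j _ hj => horth i j hj.symm
  · exact fun h => absurd hi h

/-- The Rademacher–Menshov maximal inequality for a block of `2 ^ k` orthogonal functions. -/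
theorem exists_majorant_sq_partial_sums (hint : ∀ m n, Integrable (fun x => φ m x * φ n x) μ)
    (horth : ∀ m n, m ≠ n → ∫ x, φ m x * φ n x ∂μ = 0) (k a : ℕ) :
    ∃ G : α → ℝ, Integrable G μ ∧ (∀ x, 0 ≤ G x) ∧
      ∫ x, G x ∂μ ≤ (k + 1) * ∑ i ∈ Finset.Ico a (a + 2 ^ k), ∫ x, φ i x ^ 2 ∂μ ∧
      ∀ m ≤ 2 ^ k, ∀ x, (∑ i ∈ Finset.Ico a (a + m), φ i x) ^ 2 ≤ (k + 1) * G x := by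
  induction k generalizing a with
  | zero =>
    refine ⟨fun x => φ a x ^ 2, ?_, fun x => sq_nonneg _, by simp, fun m hm x => ?_⟩
    · simpa only [sq] using hint a a
    · rw [pow_zero] at hm
      interval_cases m
      · simpa using sq_nonneg (φ a x)
      · simp
  | succ k ih =>
    obtain ⟨G₁, i₁, p₁, b₁, m₁⟩ := ih a
    obtain ⟨G₂, i₂, p₂, b₂, m₂⟩ := ih (a + 2 ^ k)
    have hsq := integrable_sq_sum hint (Finset.Ico a (a + 2 ^ k))
    -- An initial segment of the double block lies in the left half, or is the whole left half plus
    -- an initial segment of the right half; the majorant adds up what both cases need.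
    refine ⟨fun x => (∑ i ∈ Finset.Ico a (a + 2 ^ k), φ i x) ^ 2 + (G₁ x + G₂ x),
      hsq.add (i₁.add i₂), fun x => add_nonneg (sq_nonneg _) (add_nonneg (p₁ x) (p₂ x)), ?_, ?_⟩
    · have hi : Integrable (fun x => G₁ x + G₂ x) μ := i₁.add i₂
      beta_reduce
      rw [integral_add hsq hi, integral_add i₁ i₂, integral_sq_sum hint horth,
        show a + 2 ^ (k + 1) = a + 2 ^ k + 2 ^ k by ring,
        ← Finset.sum_Ico_consecutive (fun i => ∫ x, φ i x ^ 2 ∂μ)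
          (Nat.le_add_right a (2 ^ k)) (Nat.le_add_right (a + 2 ^ k) (2 ^ k))]
      have : 0 ≤ ∑ i ∈ Finset.Ico (a + 2 ^ k) (a + 2 ^ k + 2 ^ k), ∫ x, φ i x ^ 2 ∂μ :=
        Finset.sum_nonneg fun i _ => integral_nonneg fun x => sq_nonneg _
      push_cast
      linarith
    · intro m hm x
      have hk : (0 : ℝ) < k + 1 := by positivity
      push_cast
      rcases le_total m (2 ^ k) with h | h
      · have h1 := m₁ m h x
        have h2 := sq_nonneg (∑ i ∈ Finset.Ico a (a + 2 ^ k), φ i x)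
        have h3 := p₁ x
        have h4 := p₂ x
        nlinarith
      · obtain ⟨l, rfl⟩ := Nat.exists_eq_add_of_le h
        have h1 := m₂ l (by rw [pow_succ] at hm; omega) x
        rw [← add_assoc a, ← Finset.sum_Ico_consecutive (fun i => φ i x)
          (Nat.le_add_right a (2 ^ k)) (Nat.le_add_right (a + 2 ^ k) l)]
        generalize (∑ i ∈ Finset.Ico a (a + 2 ^ k), φ i x) = u at *
        generalize (∑ i ∈ Finset.Ico (a + 2 ^ k) (a + 2 ^ k + l), φ i x) = v at *
        have h2 : v ^ 2 / (k + 1) ≤ G₂ x := by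
          rw [div_le_iff₀ hk]
          linarith
        -- Cauchy–Schwarz with weights 1 and k + 1, so that the constant grows only from k + 1 to k
        -- + 2.
        have h3 : (u + v) ^ 2 ≤ (k + 1 + 1) * (u ^ 2 + v ^ 2 / (k + 1)) := by
          have : (k + 1 + 1) * (u ^ 2 + v ^ 2 / (k + 1)) - (u + v) ^ 2
              = ((k + 1) * u - v) ^ 2 / (k + 1 : ℝ) := by
            field_simp
            ring
          have : 0 ≤ ((k + 1) * u - v) ^ 2 / (k + 1 : ℝ) := by positivity
          linarith
        refine h3.trans (mul_le_mul_of_nonneg_left ?_ (by positivity))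
        linarith [p₁ x]

/-- Nonnegative functions with summable integrals tend to zero almost everywhere. -/
theorem ae_tendsto_zero_of_summable_integral {g : ℕ → α → ℝ} (hg : ∀ k, Integrable (g k) μ)
    (hpos : ∀ k x, 0 ≤ g k x) (hsum : Summable fun k => ∫ x, g k x ∂μ) :
    ∀ᵐ x ∂μ, Tendsto (fun k => g k x) atTop (𝓝 0) := by
  have h1 : ∫⁻ x, ∑' k, ENNReal.ofReal (g k x) ∂μ ≠ ⊤ := by
    rw [lintegral_tsum fun k => (hg k).aemeasurable.ennreal_ofReal]
    simp_rw [← ofReal_integral_eq_lintegral_ofReal (hg _) (Eventually.of_forall (hpos _))]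
    exact hsum.tsum_ofReal_ne_top
  have h2 := ae_lt_top' (AEMeasurable.tsum fun k => (hg k).aemeasurable.ennreal_ofReal) h1
  filter_upwards [h2] with x hx
  have := (ENNReal.tendsto_toReal ENNReal.zero_ne_top).comp
    (ENNReal.tendsto_atTop_zero_of_tsum_ne_top hx.ne)
  refine this.congr fun k => ?_
  simp [hpos k x]

/-- The blocks [2^k, 2^(k+1)) are disjoint and tile the positive integers. -/
theorem summable_sum_dyadic {u : ℕ → ℝ} (hu : Summable u) (hpos : ∀ n, 0 ≤ u n) :
    Summable fun k => ∑ n ∈ Finset.Ico (2 ^ k) (2 ^ k + 2 ^ k), u n := by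
  refine summable_of_sum_range_le (c := ∑' n, u n)
    (fun k => Finset.sum_nonneg fun n _ => hpos n) fun K => ?_
  have : ∑ k ∈ Finset.range K, ∑ n ∈ Finset.Ico (2 ^ k) (2 ^ k + 2 ^ k), u n
      = ∑ n ∈ Finset.Ico 1 (2 ^ K), u n := by
    induction K with
    | zero => simp
    | succ K ih =>
      rw [Finset.sum_range_succ, ih, Finset.sum_Ico_consecutive _ Nat.one_le_two_pow (Nat.le_add_right _ _),
        ← two_mul, ← pow_succ']
  rw [this]
  exact hu.sum_le_tsum _ fun n _ => hpos n

/-- The **Rademacher–Menshov theorem**: an orthogonal series that converges in mean square to `f`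
converges to `f` almost everywhere if the squared norms are summable with weights `log ^ 2`. -/
theorem rademacher_menshov (hint : ∀ m n, Integrable (fun x => φ m x * φ n x) μ)
    (horth : ∀ m n, m ≠ n → ∫ x, φ m x * φ n x ∂μ = 0) {f : α → ℝ} {E : ℝ}
    (hf : ∀ N, Integrable (fun x => (f x - ∑ n ∈ Finset.range N, φ n x) ^ 2) μ)
    (hE : HasSum (fun n => ∫ x, φ n x ^ 2 ∂μ) E)
    (htail : ∀ N, ∫ x, (f x - ∑ n ∈ Finset.range N, φ n x) ^ 2 ∂μ
      = E - ∑ n ∈ Finset.range N, ∫ x, φ n x ^ 2 ∂μ)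
    (hlog : Summable fun n : ℕ => (∫ x, φ n x ^ 2 ∂μ) * Real.log n ^ 2) :
    ∀ᵐ x ∂μ, Tendsto (fun N => ∑ n ∈ Finset.range N, φ n x) atTop (𝓝 (f x)) := by
  set e : ℕ → ℝ := fun n => ∫ x, φ n x ^ 2 ∂μ with he
  have he0 : ∀ n, 0 ≤ e n := fun n => integral_nonneg fun x => sq_nonneg _
  have hu0 : ∀ n : ℕ, 0 ≤ e n * Real.log n ^ 2 := fun n => mul_nonneg (he0 n) (sq_nonneg _)
  have hl2 : 0 < Real.log 2 := Real.log_pos one_lt_two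
  have hcmp : ∀ k n : ℕ, 2 ^ k ≤ n →
      (k : ℝ) ^ 2 * e n ≤ (1 / Real.log 2 ^ 2) * (e n * Real.log n ^ 2) := by
    intro k n hn
    have h1 : (k : ℝ) * Real.log 2 ≤ Real.log n := by
      rw [← Real.log_pow]
      exact Real.log_le_log (by positivity) (by exact_mod_cast hn)
    have h2 : ((k : ℝ) * Real.log 2) ^ 2 ≤ Real.log n ^ 2 :=
      pow_le_pow_left₀ (by positivity) h1 2
    have h3 : (k : ℝ) ^ 2 ≤ Real.log n ^ 2 / Real.log 2 ^ 2 := by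
      rw [le_div_iff₀ (by positivity), ← mul_pow]
      exact h2
    calc (k : ℝ) ^ 2 * e n ≤ Real.log n ^ 2 / Real.log 2 ^ 2 * e n :=
          mul_le_mul_of_nonneg_right h3 (he0 n)
      _ = _ := by ring
  have hsub : ∀ᵐ x ∂μ,
      Tendsto (fun k => (f x - ∑ n ∈ Finset.range (2 ^ k), φ n x) ^ 2) atTop (𝓝 0) := by
    refine ae_tendsto_zero_of_summable_integral (fun k => hf (2 ^ k)) (fun k x => sq_nonneg _) ?_
    set W := ∑' n : ℕ, e n * Real.log n ^ 2 with hW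
    -- By `hcmp` the tail from 2^(k+1) on is at most W / ((k+1)² log² 2). The index is shifted
    -- because the weight k² is useless at k = 0.
    refine (summable_nat_add_iff 1).1 (Summable.of_nonneg_of_le
      (fun k => integral_nonneg fun x => sq_nonneg _) (fun k => ?_)
      (((summable_nat_add_iff 1).2 (Real.summable_nat_pow_inv.2 one_lt_two)).mul_left
        (1 / Real.log 2 ^ 2 * W)))
    rw [htail, ← div_eq_mul_inv, le_div_iff₀ (by positivity), mul_comm]
    have h1 := hasSum_le (fun n => hcmp (k + 1) (n + 2 ^ (k + 1)) (Nat.le_add_left _ _))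
      (((hasSum_nat_add_iff' (2 ^ (k + 1))).2 hE).mul_left _)
      (((hasSum_nat_add_iff' (2 ^ (k + 1))).2 hlog.hasSum).mul_left _)
    refine h1.trans (mul_le_mul_of_nonneg_left ?_ (by positivity))
    exact sub_le_self _ (Finset.sum_nonneg fun n _ => hu0 n)
  have hmaj : ∀ k : ℕ, ∃ G : α → ℝ, Integrable G μ ∧ (∀ x, 0 ≤ G x) ∧
      ∫ x, G x ∂μ ≤ (k + 1 : ℝ) ^ 2 * ∑ i ∈ Finset.Ico (2 ^ k) (2 ^ k + 2 ^ k), e i ∧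
      ∀ m ≤ 2 ^ k, ∀ x, (∑ i ∈ Finset.Ico (2 ^ k) (2 ^ k + m), φ i x) ^ 2 ≤ G x := by
    intro k
    obtain ⟨G, h1, h2, h3, h4⟩ := exists_majorant_sq_partial_sums hint horth k (2 ^ k)
    refine ⟨fun x => (k + 1) * G x, h1.const_mul _, fun x => mul_nonneg (by positivity) (h2 x),
      ?_, h4⟩
    rw [integral_const_mul, sq, mul_assoc]
    exact mul_le_mul_of_nonneg_left h3 (by positivity)
  choose G hGi hG0 hGb hGm using hmaj
  have hG : ∀ᵐ x ∂μ, Tendsto (fun k => G k x) atTop (𝓝 0) := by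
    refine ae_tendsto_zero_of_summable_integral hGi hG0 ?_
    refine (summable_nat_add_iff 1).1 (Summable.of_nonneg_of_le
      (fun k => integral_nonneg (hG0 _)) (fun k => ?_)
      (((summable_nat_add_iff 1).2 (summable_sum_dyadic hlog hu0)).mul_left (4 / Real.log 2 ^ 2)))
    refine (hGb _).trans ?_
    rw [Finset.mul_sum, Finset.mul_sum]
    refine Finset.sum_le_sum fun n hn => ?_
    have h1 := hcmp (k + 1) n (Finset.mem_Ico.1 hn).1
    have h2 : (((k + 1 : ℕ) : ℝ) + 1) ^ 2 ≤ 4 * ((k + 1 : ℕ) : ℝ) ^ 2 := by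
      push_cast
      nlinarith [(Nat.cast_nonneg k : (0 : ℝ) ≤ k)]
    calc (((k + 1 : ℕ) : ℝ) + 1) ^ 2 * e n ≤ 4 * ((k + 1 : ℕ) : ℝ) ^ 2 * e n :=
          mul_le_mul_of_nonneg_right h2 (he0 n)
      _ ≤ 4 * ((1 / Real.log 2 ^ 2) * (e n * Real.log n ^ 2)) := by linarith
      _ = _ := by ring
  filter_upwards [hsub, hG] with x hx hGx
  have hlogt : Tendsto (fun N : ℕ => Nat.log 2 N) atTop atTop := by
    refine tendsto_atTop.2 fun b => ?_
    filter_upwards [eventually_ge_atTop (2 ^ b)] with N hN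
    exact Nat.le_log_of_pow_le one_lt_two hN
  have hsum := ((hx.const_mul 2).add (hGx.const_mul 2)).comp hlogt
  simp only [mul_zero, add_zero] at hsum
  -- Up to N the sum is a dyadic partial sum u plus a piece v of one block, and (f - u - v)² ≤ 2 (f
  -- - u)² + 2 v².
  have hsq : Tendsto (fun N => (f x - ∑ n ∈ Finset.range N, φ n x) ^ 2) atTop (𝓝 0) := by
    refine squeeze_zero' (Eventually.of_forall fun N => sq_nonneg _) ?_ hsum
    filter_upwards [eventually_gt_atTop 0] with N hN
    have h1 : 2 ^ Nat.log 2 N ≤ N := Nat.pow_log_le_self 2 hN.ne'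
    have h2 : N < 2 ^ (Nat.log 2 N + 1) := Nat.lt_pow_succ_log_self one_lt_two N
    obtain ⟨m, hm⟩ := Nat.exists_eq_add_of_le h1
    have h3 := hGm (Nat.log 2 N) m (by rw [pow_succ] at h2; omega) x
    rw [← hm] at h3
    have h4 := Finset.sum_range_add_sum_Ico (fun n => φ n x) h1
    rw [Function.comp_apply, ← h4]
    generalize (∑ n ∈ Finset.range (2 ^ Nat.log 2 N), φ n x) = u at *
    generalize (∑ n ∈ Finset.Ico (2 ^ Nat.log 2 N) N, φ n x) = v at *
    nlinarith [sq_nonneg (f x - u + v)]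
  have habs := (hsq.sqrt)
  simp only [Real.sqrt_zero, Real.sqrt_sq_eq_abs] at habs
  have := (tendsto_zero_iff_abs_tendsto_zero _).2 habs
  simpa using tendsto_const_nhds (x := f x) |>.sub this

end Orthogonal

/-! ### Moment functionals and the polynomials a_n -/

section Algebra

open Polynomial

/-- Division by x + D: it trades integrals against A, or against w² dB, for integrals with one
factor x + D cancelled. -/
theorem Polynomial.exists_eq_X_add_C_mul_add_C (D : ℝ) (q : ℝ[X]) :
    ∃ r : ℝ[X], q = (X + C D) * r + C (q.eval (-D)) ∧
      ∀ n : ℕ, q.degree < (n + 1 : ℕ) → r.degree < n := by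
  refine ⟨q /ₘ (X - C (-D)), ?_, fun n hn => ?_⟩
  · have := modByMonic_add_div q (X - C (-D))
    rw [modByMonic_X_sub_C_eq_C_eval] at this
    rw [← sub_neg_eq_add X, ← C_neg, add_comm, this]
  · by_cases h : q /ₘ (X - C (-D)) = 0
    · rw [h, degree_zero]
      exact WithBot.bot_lt_coe n
    rw [← natDegree_lt_iff_degree_lt h, natDegree_divByMonic _ (monic_X_sub_C _),
      natDegree_X_sub_C]
    have hq : q ≠ 0 := by
      rintro rfl
      simp at h
    have hd : ¬ q.degree < (X - C (-D)).degree := fun hlt =>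
      h ((divByMonic_eq_zero_iff (monic_X_sub_C _)).2 hlt)
    rw [degree_X_sub_C, not_lt] at hd
    have h1 : 1 ≤ q.natDegree := by
      rw [degree_eq_natDegree hq] at hd
      exact_mod_cast hd
    have := (natDegree_lt_iff_degree_lt hq).2 hn
    omega

theorem Polynomial.exists_eq_sum_of_monic {p : ℕ → ℝ[X]} (hm : ∀ n, (p n).Monic)
    (hd : ∀ n, (p n).natDegree = n) (N : ℕ) (q : ℝ[X]) (hq : q.degree < N) :
    ∃ c : ℕ → ℝ, q = ∑ n ∈ Finset.range N, C (c n) * p n := by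
  induction N generalizing q with
  | zero =>
    refine ⟨0, ?_⟩
    simpa using hq
  | succ N ih =>
    have hdeg : (q - C (q.coeff N) * p N).degree < N := by
      rw [degree_lt_iff_coeff_zero]
      intro k hk
      rw [coeff_sub, coeff_C_mul]
      rcases hk.eq_or_lt with rfl | hk
      · have := (hm N).coeff_natDegree
        rw [hd] at this
        rw [this, mul_one, sub_self]
      · rw [coeff_eq_zero_of_degree_lt (hq.trans_le (by exact_mod_cast hk)),
          coeff_eq_zero_of_natDegree_lt ((hd N).trans_lt hk), mul_zero, sub_zero]
    obtain ⟨c, hc⟩ := ih _ hdeg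
    refine ⟨Function.update c N (q.coeff N), ?_⟩
    rw [Finset.sum_range_succ, Function.update_self, ← sub_eq_iff_eq_add, hc]
    refine Finset.sum_congr rfl fun n hn => ?_
    rw [Function.update_of_ne (Finset.mem_range.1 hn).ne]

theorem Polynomial.functional_mul_eq_zero {p : ℕ → ℝ[X]} (hm : ∀ n, (p n).Monic)
    (hd : ∀ n, (p n).natDegree = n) {L : ℝ[X] →ₗ[ℝ] ℝ}
    (horth : ∀ m n, m ≠ n → L (p m * p n) = 0) {n : ℕ} {q : ℝ[X]} (hq : q.degree < n) :
    L (p n * q) = 0 := by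
  obtain ⟨c, rfl⟩ := exists_eq_sum_of_monic hm hd n q hq
  rw [Finset.mul_sum, map_sum]
  refine Finset.sum_eq_zero fun k hk => ?_
  rw [mul_left_comm, ← smul_eq_C_mul, map_smul, horth n k (Finset.mem_range.1 hk).ne', smul_zero]

theorem bPoly_recurrence (β γ : ℕ → ℝ) (n : ℕ) :
    bPoly β γ (n + 2) = (X - C (β (n + 1))) * bPoly β γ (n + 1) - C (γ n) * bPoly β γ n := rfl

theorem bPoly_eq_sum_aPoly (β γ : ℕ → ℝ) (c D : ℝ) (n : ℕ) :
    bPoly β γ n = aPoly β γ c D n + ∑ j ∈ Finset.Icc 1 n,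
      C ((-1) ^ j * ∏ k ∈ Finset.Icc (n - j + 1) n, kappa β γ c D k) * aPoly β γ c D (n - j) := by
  have key : bPoly β γ n = ∑ j ∈ Finset.range (n + 1),
      C ((-1) ^ j * ∏ k ∈ Finset.Icc (n - j + 1) n, kappa β γ c D k)
        * aPoly β γ c D (n - j) := by
    induction n with
    | zero => simp [aPoly]
    | succ n ih =>
      -- The expansion is b_{n+1} = a_{n+1} - κ_{n+1} b_n, iterated.
      have h1 : bPoly β γ (n + 1)
          = aPoly β γ c D (n + 1) - C (kappa β γ c D (n + 1)) * bPoly β γ n := by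
        simp [aPoly]
      rw [h1, ih, Finset.sum_range_succ' _ (n + 1), Finset.mul_sum, sub_eq_neg_add,
        ← Finset.sum_neg_distrib]
      congr 1
      · refine Finset.sum_congr rfl fun j _ => ?_
        rw [Nat.add_sub_add_right, Finset.prod_Icc_succ_top (by omega)]
        simp only [C_mul, pow_succ, C_neg, C_1]
        ring
      · simp
  rw [key, Finset.range_eq_Ico, Finset.sum_eq_sum_Ico_succ_bot (Nat.succ_pos n)]
  congr 1
  simp

theorem aPoly_monic_natDegree {β γ : ℕ → ℝ} (hm : ∀ n, (bPoly β γ n).Monic)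
    (hd : ∀ n, (bPoly β γ n).natDegree = n) (c D : ℝ) (n : ℕ) :
    (aPoly β γ c D n).Monic ∧ (aPoly β γ c D n).natDegree = n := by
  cases n with
  | zero => exact ⟨hm 0, hd 0⟩
  | succ n =>
    have hlt : (C (kappa β γ c D (n + 1)) * bPoly β γ n).natDegree
        < (bPoly β γ (n + 1)).natDegree := by
      refine (natDegree_C_mul_le _ _).trans_lt ?_
      rw [hd, hd]
      exact n.lt_succ_self
    have hlt' := degree_lt_degree hlt
    exact ⟨(hm (n + 1)).add_of_left hlt',
      (natDegree_add_eq_left_of_natDegree_lt hlt).trans (hd (n + 1))⟩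

/-- The recurrence coefficients of a monic orthogonal sequence are the ratios of the consecutive
squared norms. -/
theorem bPoly_functional_sq_succ {β γ : ℕ → ℝ} (hm : ∀ n, (bPoly β γ n).Monic)
    (hd : ∀ n, (bPoly β γ n).natDegree = n) {L : ℝ[X] →ₗ[ℝ] ℝ}
    (horth : ∀ m n, m ≠ n → L (bPoly β γ m * bPoly β γ n) = 0) (n : ℕ) :
    L (bPoly β γ (n + 1) * bPoly β γ (n + 1)) = γ n * L (bPoly β γ n * bPoly β γ n) := by
  have hdiff : (bPoly β γ (n + 1) - X * bPoly β γ n).degree < ((n + 1 : ℕ) : WithBot ℕ) := by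
    have h1 : (X * bPoly β γ n).Monic := monic_X.mul (hm n)
    have h2 : (X * bPoly β γ n).natDegree = n + 1 := by
      rw [natDegree_X_mul (hm n).ne_zero, hd]
    have h3 := degree_sub_lt_left (p := bPoly β γ (n + 1)) (q := X * bPoly β γ n)
      (by rw [degree_eq_natDegree (hm _).ne_zero, degree_eq_natDegree h1.ne_zero, h2, hd])
      (hm _).ne_zero (by rw [(hm _).leadingCoeff, h1.leadingCoeff])
    rwa [degree_eq_natDegree (hm (n + 1)).ne_zero, hd] at h3
  have h1 := functional_mul_eq_zero hm hd horth hdiff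
  rw [mul_sub, map_sub, sub_eq_zero] at h1
  -- The factor x is moved onto b_{n+1} and expanded by the recurrence; only the γ term survives
  -- `L`.
  have h2 : bPoly β γ (n + 1) * (X * bPoly β γ n)
      = bPoly β γ (n + 2) * bPoly β γ n + β (n + 1) • (bPoly β γ (n + 1) * bPoly β γ n)
        + γ n • (bPoly β γ n * bPoly β γ n) := by
    rw [bPoly_recurrence, smul_eq_C_mul, smul_eq_C_mul]
    ring
  rw [h1, h2, map_add, map_add, map_smul, map_smul, horth _ _ (by omega), horth _ _ (by omega)]
  simp

section Transform

variable {β γ : ℕ → ℝ} {c D : ℝ} {LA LB : ℝ[X] →ₗ[ℝ] ℝ}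

/-- With b_n = (x + D) r + b_n(-D), LA(b_n²) = c LB(b_n r) + b_n(-D) LA(b_n). The first term
vanishes as deg r < n, so LA(b_n) = 0 would contradict positivity. -/
theorem functional_bPoly_ne_zero (hm : ∀ n, (bPoly β γ n).Monic)
    (hd : ∀ n, (bPoly β γ n).natDegree = n)
    (horth : ∀ m n, m ≠ n → LB (bPoly β γ m * bPoly β γ n) = 0)
    (hpos : ∀ q, q ≠ 0 → 0 < LA (q * q)) (hAB : ∀ r, LA ((X + C D) * r) = c * LB r) (n : ℕ) :
    LA (bPoly β γ n) ≠ 0 := by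
  intro h0
  obtain ⟨r, hr, hdeg⟩ := exists_eq_X_add_C_mul_add_C D (bPoly β γ n)
  have hr' : r.degree < n := hdeg n (by
    rw [degree_eq_natDegree (hm n).ne_zero, hd]
    exact_mod_cast n.lt_succ_self)
  have h1 : bPoly β γ n * bPoly β γ n
      = (X + C D) * (bPoly β γ n * r) + (bPoly β γ n).eval (-D) • bPoly β γ n := by
    rw [smul_eq_C_mul]
    nth_rw 2 [hr]
    ring
  have h2 := hpos _ (hm n).ne_zero
  rw [h1, map_add, map_smul, hAB, functional_mul_eq_zero hm hd horth hr', h0] at h2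
  simp at h2

/-- In the recurrence x = (x + D) - D, and the x + D term contributes c LB(b_{n+1}) = 0. What
remains is the recursion defining κ; c itself enters only through b_1. -/
theorem functional_bPoly_succ (hm : ∀ n, (bPoly β γ n).Monic)
    (hd : ∀ n, (bPoly β γ n).natDegree = n)
    (horth : ∀ m n, m ≠ n → LB (bPoly β γ m * bPoly β γ n) = 0)
    (hpos : ∀ q, q ≠ 0 → 0 < LA (q * q)) (hAB : ∀ r, LA ((X + C D) * r) = c * LB r)
    (hA1 : LA 1 = 1) (hB1 : LB 1 = 1) (n : ℕ) :
    LA (bPoly β γ (n + 1)) = -kappa β γ c D (n + 1) * LA (bPoly β γ n) := by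
  induction n with
  | zero =>
    have h : bPoly β γ 1 = (X + C D) * 1 - (D + β 0) • (1 : ℝ[X]) := by
      rw [smul_eq_C_mul, C_add]
      change X - C (β 0) = _
      ring
    rw [h, map_sub, hAB, map_smul, hB1, show bPoly β γ 0 = 1 from rfl, hA1]
    simp only [kappa, smul_eq_mul]
    ring
  | succ n ih =>
    have hne := functional_bPoly_ne_zero hm hd horth hpos hAB (n + 1)
    -- Needed so that the quotient in `kappa` is a genuine division.
    have hκ : kappa β γ c D (n + 1) ≠ 0 := by
      intro h
      rw [ih, h] at hne
      simp at hne
    have h0 : LB (bPoly β γ (n + 1)) = 0 := by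
      simpa [bPoly] using horth (n + 1) 0 (by omega)
    have h : bPoly β γ (n + 2) = (X + C D) * bPoly β γ (n + 1)
        - (D + β (n + 1)) • bPoly β γ (n + 1) - γ n • bPoly β γ n := by
      rw [bPoly_recurrence]
      simp only [smul_eq_C_mul, C_add]
      ring
    rw [show n + 1 + 1 = n + 2 from rfl, h, map_sub, map_sub, hAB, map_smul, map_smul, h0, ih]
    simp only [kappa, smul_eq_mul]
    field_simp
    ring

theorem functional_aPoly_mul_eq_zero (hm : ∀ n, (bPoly β γ n).Monic)
    (hd : ∀ n, (bPoly β γ n).natDegree = n)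
    (horth : ∀ m n, m ≠ n → LB (bPoly β γ m * bPoly β γ n) = 0)
    (hpos : ∀ q, q ≠ 0 → 0 < LA (q * q)) (hAB : ∀ r, LA ((X + C D) * r) = c * LB r)
    (hA1 : LA 1 = 1) (hB1 : LB 1 = 1) {n : ℕ} {q : ℝ[X]} (hq : q.degree < n) :
    LA (aPoly β γ c D n * q) = 0 := by
  cases n with
  | zero =>
    have : q = 0 := by simpa using hq
    simp [this]
  | succ n =>
    obtain ⟨r, hr, hdeg⟩ := exists_eq_X_add_C_mul_add_C D q
    have hr' := hdeg n hq
    have hr'' : r.degree < (n + 1 : ℕ) := hr'.trans (by exact_mod_cast n.lt_succ_self)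
    -- The x + D part dies by orthogonality under `LB`, the constant part because κ makes `LA`
    -- vanish on a_{n+1}.
    have h : aPoly β γ c D (n + 1) * q
        = (X + C D) * (bPoly β γ (n + 1) * r + kappa β γ c D (n + 1) • (bPoly β γ n * r))
          + q.eval (-D) • (bPoly β γ (n + 1) + kappa β γ c D (n + 1) • bPoly β γ n) := by
      simp only [smul_eq_C_mul, aPoly]
      nth_rw 1 [hr]
      ring
    rw [h, map_add, hAB, map_smul, map_add, map_add, map_smul, map_smul,
      functional_mul_eq_zero hm hd horth hr', functional_mul_eq_zero hm hd horth hr'',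
      functional_bPoly_succ hm hd horth hpos hAB hA1 hB1]
    simp

end Transform

end Algebra

/-! ### Moments and mean-square distances -/

section Moments

/-- The moment functional of a measure all of whose moments exist. -/
noncomputable def momentFunctional (μ : Measure ℝ)
    (h : ∀ q : Polynomial ℝ, Integrable (fun x => q.eval x) μ) : Polynomial ℝ →ₗ[ℝ] ℝ where
  toFun q := ∫ x, q.eval x ∂μ
  map_add' p q := by
    simp only [Polynomial.eval_add]
    exact integral_add (h p) (h q)
  map_smul' c p := by
    simp only [Polynomial.eval_smul, smul_eq_mul, RingHom.id_apply]
    exact integral_const_mul _ _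

theorem momentFunctional_apply {μ : Measure ℝ}
    (h : ∀ q : Polynomial ℝ, Integrable (fun x => q.eval x) μ) (q : Polynomial ℝ) :
    momentFunctional μ h q = ∫ x, q.eval x ∂μ := rfl

theorem momentFunctional_mul {μ : Measure ℝ}
    (h : ∀ q : Polynomial ℝ, Integrable (fun x => q.eval x) μ) (p q : Polynomial ℝ) :
    momentFunctional μ h (p * q) = ∫ x, p.eval x * q.eval x ∂μ := by
  simp [momentFunctional_apply]

namespace IsMonicOrthogonal

variable {μ : Measure ℝ} {p : ℕ → Polynomial ℝ}

theorem exists_eq_sum (h : IsMonicOrthogonal μ p) (q : Polynomial ℝ) : ∃ (N : ℕ) (c : ℕ → ℝ),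
    q = ∑ n ∈ Finset.range N, Polynomial.C (c n) * p n := by
  refine ⟨q.natDegree + 1,
    Polynomial.exists_eq_sum_of_monic h.monic h.natDegree_eq _ q ?_⟩
  exact Polynomial.degree_le_natDegree.trans_lt (by exact_mod_cast q.natDegree.lt_succ_self)

theorem zero_eq_one (h : IsMonicOrthogonal μ p) : p 0 = 1 :=
  (h.monic 0).natDegree_eq_zero.1 (h.natDegree_eq 0)

theorem integrable_eval (h : IsMonicOrthogonal μ p) (q : Polynomial ℝ) :
    Integrable (fun x => q.eval x) μ := by
  obtain ⟨N, c, rfl⟩ := h.exists_eq_sum q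
  simp only [Polynomial.eval_finsetSum, Polynomial.eval_mul, Polynomial.eval_C]
  refine integrable_finsetSum _ fun n _ => Integrable.const_mul ?_ _
  simpa [h.zero_eq_one] using h.integrable n 0

theorem integral_sq_pos (h : IsMonicOrthogonal μ p) {q : Polynomial ℝ} (hq : q ≠ 0) :
    0 < ∫ x, q.eval x ^ 2 ∂μ := by
  obtain ⟨N, c, rfl⟩ := h.exists_eq_sum q
  simp only [Polynomial.eval_finsetSum, Polynomial.eval_mul, Polynomial.eval_C]
  rw [integral_sq_sum (φ := fun n x => c n * (p n).eval x)]
  · simp only [mul_pow, integral_const_mul]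
    refine Finset.sum_pos' (fun n _ => mul_nonneg (sq_nonneg _) (h.norm_pos n).le) ?_
    by_contra! hc
    refine hq (Finset.sum_eq_zero fun n hn => ?_)
    have h1 := hc n hn
    have h2 : c n = 0 := by
      by_contra h3
      have := mul_pos (sq_pos_of_ne_zero h3) (h.norm_pos n)
      linarith
    rw [h2, Polynomial.C_0, zero_mul]
  · intro m n
    refine ((h.integrable m n).const_mul (c m * c n)).congr (.of_forall fun x => ?_)
    ring
  · intro m n hmn
    rw [← mul_zero (c m * c n), ← h.orthogonal m n hmn, ← integral_const_mul]
    exact integral_congr_ae (.of_forall fun x => by ring)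

/-- Lets uniqueness of the orthogonality measure be used as determinacy of the moment problem. -/
theorem congr_moments {ν : Measure ℝ} (h : IsMonicOrthogonal μ p)
    (hi : ∀ q : Polynomial ℝ, Integrable (fun x => q.eval x) ν)
    (he : ∀ q : Polynomial ℝ, ∫ x, q.eval x ∂ν = ∫ x, q.eval x ∂μ) : IsMonicOrthogonal ν p where
  monic := h.monic
  natDegree_eq := h.natDegree_eq
  integrable m n := by simpa using hi (p m * p n)
  orthogonal m n hmn := by simpa [h.orthogonal m n hmn] using he (p m * p n)
  norm_pos n := by
    have := he (p n ^ 2)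
    simp only [Polynomial.eval_pow] at this
    exact this ▸ h.norm_pos n

/-- The coefficients are arbitrary: Fourier coefficients give Bessel's identity, others give the
comparison with a general polynomial. -/
theorem integral_sub_sum_sq (h : IsMonicOrthogonal μ p) {f : ℝ → ℝ}
    (hf : Integrable (fun x => f x ^ 2) μ) (hfp : ∀ n, Integrable (fun x => f x * (p n).eval x) μ)
    (c : ℕ → ℝ) (N : ℕ) :
    Integrable (fun x => (f x - ∑ n ∈ Finset.range N, c n * (p n).eval x) ^ 2) μ ∧
    ∫ x, (f x - ∑ n ∈ Finset.range N, c n * (p n).eval x) ^ 2 ∂μ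
      = ∫ x, f x ^ 2 ∂μ + ∑ n ∈ Finset.range N,
        (c n ^ 2 * ∫ x, (p n).eval x ^ 2 ∂μ - 2 * c n * ∫ x, f x * (p n).eval x ∂μ) := by
  have hint : ∀ m n, Integrable
      (fun x => (c m * (p m).eval x) * (c n * (p n).eval x)) μ := by
    intro m n
    refine ((h.integrable m n).const_mul (c m * c n)).congr (.of_forall fun x => ?_)
    ring
  have horth : ∀ m n, m ≠ n → ∫ x, (c m * (p m).eval x) * (c n * (p n).eval x) ∂μ = 0 := by
    intro m n hmn
    rw [← mul_zero (c m * c n), ← h.orthogonal m n hmn, ← integral_const_mul]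
    exact integral_congr_ae (.of_forall fun x => by ring)
  have hexp : ∀ x, (f x - ∑ n ∈ Finset.range N, c n * (p n).eval x) ^ 2
      = f x ^ 2 + (∑ n ∈ Finset.range N, c n * (p n).eval x) ^ 2
        - ∑ n ∈ Finset.range N, 2 * c n * (f x * (p n).eval x) := by
    intro x
    have : ∑ n ∈ Finset.range N, 2 * c n * (f x * (p n).eval x)
        = 2 * f x * ∑ n ∈ Finset.range N, c n * (p n).eval x := by
      rw [Finset.mul_sum]
      exact Finset.sum_congr rfl fun n _ => by ring
    rw [this]
    ring
  have i1 := integrable_sq_sum (φ := fun n x => c n * (p n).eval x) hint (Finset.range N)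
  have i2 : Integrable (fun x => ∑ n ∈ Finset.range N, 2 * c n * (f x * (p n).eval x)) μ :=
    integrable_finsetSum _ fun n _ => (hfp n).const_mul _
  have i3 : Integrable (fun x => f x ^ 2 + (∑ n ∈ Finset.range N, c n * (p n).eval x) ^ 2) μ :=
    hf.add i1
  simp only [hexp]
  refine ⟨i3.sub i2, ?_⟩
  rw [integral_sub i3 i2, integral_add hf i1,
    integral_sq_sum (φ := fun n x => c n * (p n).eval x) hint horth,
    integral_finsetSum _ fun n _ => (hfp n).const_mul _, Finset.sum_sub_distrib]
  simp only [mul_pow, integral_const_mul]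
  ring

end IsMonicOrthogonal

end Moments

/-! ### Polynomial approximation of C/(x + D) -/

/-- If the moment problem for `B` is determinate and `B` has no atom at `-D`, then a square
integrable multiple of `1 / (x + D)` is approximated by polynomials in mean square. -/
theorem exists_polynomial_integral_sub_sq_lt {B : Measure ℝ} [IsProbabilityMeasure B] {C D : ℝ}
    (hC : C ≠ 0) (hD : ∀ᵐ x ∂B, x + D ≠ 0)
    (hBw : ∀ q : Polynomial ℝ, Integrable (fun x => C / (x + D) * q.eval x) B)
    (hw : Integrable (fun x => (C / (x + D)) ^ 2) B)
    (hdet : ∀ μ : Measure ℝ, IsProbabilityMeasure μ →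
      (∀ q : Polynomial ℝ, Integrable (fun x => q.eval x) μ) →
      (∀ q : Polynomial ℝ, ∫ x, q.eval x ∂μ = ∫ x, q.eval x ∂B) → μ = B)
    {ε : ℝ} (hε : 0 < ε) :
    ∃ q : Polynomial ℝ, ∫ x, (C / (x + D) - q.eval x) ^ 2 ∂B < ε := by
  by_contra! hge
  set w : ℝ → ℝ := fun x => C / (x + D) with hwdef
  have hi : ∀ q : Polynomial ℝ, Integrable (fun x => q.eval x * w x ^ 2) B := by
    intro q
    obtain ⟨r, hr, -⟩ := Polynomial.exists_eq_X_add_C_mul_add_C D q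
    refine ((hw.const_mul (q.eval (-D))).add ((hBw r).const_mul C)).congr ?_
    filter_upwards [hD] with x hx
    have h1 : q.eval x = (x + D) * r.eval x + q.eval (-D) := by
      conv_lhs => rw [hr]
      simp
    rw [h1, hwdef, Pi.add_apply]
    field_simp
    ring
  -- Formally the moments of w² dB with a mass ε removed at -D.
  let L : Polynomial ℝ →ₗ[ℝ] ℝ :=
    { toFun := fun q => ∫ x, q.eval x * w x ^ 2 ∂B - ε * q.eval (-D)
      map_add' := by
        intro p q
        simp only [Polynomial.eval_add, add_mul]
        rw [integral_add (hi p) (hi q)]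
        ring
      map_smul' := by
        intro a p
        simp only [Polynomial.eval_smul, smul_eq_mul, RingHom.id_apply, mul_assoc]
        rw [integral_const_mul]
        ring }
  have hL : ∀ q, L q = ∫ x, q.eval x * w x ^ 2 ∂B - ε * q.eval (-D) := fun q => rfl
  have hLpos : ∀ p, 0 ≤ L (p * p) := by
    intro p
    rw [hL, sub_nonneg]
    by_cases hp : p.eval (-D) = 0
    · rw [Polynomial.eval_mul, hp, mul_zero, mul_zero]
      refine integral_nonneg fun x => ?_
      rw [Polynomial.eval_mul]
      exact mul_nonneg (mul_self_nonneg _) (sq_nonneg _)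
    · obtain ⟨r, hr, -⟩ := Polynomial.exists_eq_X_add_C_mul_add_C D p
      set a := p.eval (-D) with ha
      -- Almost everywhere p w = a (w + (C/a) r), so the assumed distance bounds this integral below
      -- by a² ε.
      have h1 : ∫ x, (p * p).eval x * w x ^ 2 ∂B
          = a ^ 2 * ∫ x, (w x - (Polynomial.C (-(C / a)) * r).eval x) ^ 2 ∂B := by
        rw [← integral_const_mul]
        refine integral_congr_ae ?_
        filter_upwards [hD] with x hx
        have h1 : p.eval x = (x + D) * r.eval x + a := by
          conv_lhs => rw [hr]
          simp
        simp only [Polynomial.eval_mul, Polynomial.eval_C, h1, hwdef]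
        field_simp
        ring
      rw [h1, Polynomial.eval_mul, ← ha, mul_comm ε, ← sq]
      exact mul_le_mul_of_nonneg_left (hge _) (sq_nonneg a)
  obtain ⟨σ, hσ⟩ := hamburger L hLpos
  let v : ℝ → ℝ := fun x => (x + D) ^ 2 / C ^ 2
  let Q : Polynomial ℝ := (Polynomial.X + Polynomial.C D) ^ 2 * Polynomial.C (1 / C ^ 2)
  have hv0 : ∀ x, 0 ≤ v x := fun x => by positivity
  have hQ : ∀ x, Q.eval x = v x := by
    intro x
    simp [Q, v, div_eq_mul_inv]
  have hvm : Measurable fun x => ENNReal.ofReal (v x) := by fun_prop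
  have htop : ∀ᵐ x ∂σ, ENNReal.ofReal (v x) < ⊤ := .of_forall fun x => ENNReal.ofReal_lt_top
  let B' := σ.withDensity fun x => ENNReal.ofReal (v x)
  have hB'int : ∀ g : ℝ → ℝ, ∫ x, g x ∂B' = ∫ x, v x * g x ∂σ := by
    intro g
    rw [integral_withDensity_eq_integral_toReal_smul hvm htop]
    simp only [ENNReal.toReal_ofReal (hv0 _), smul_eq_mul]
  have hB'i : ∀ q : Polynomial ℝ, Integrable (fun x => q.eval x) B' := by
    intro q
    rw [integrable_withDensity_iff_integrable_smul' hvm htop]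
    simp only [ENNReal.toReal_ofReal (hv0 _), smul_eq_mul]
    simpa only [Polynomial.eval_mul, hQ] using (hσ (Q * q)).1
  -- The factor `v` cancels w² almost everywhere for B and kills the ε term, since it vanishes at
  -- -D.
  have hB'e : ∀ q : Polynomial ℝ, ∫ x, q.eval x ∂B' = ∫ x, q.eval x ∂B := by
    intro q
    have h1 := (hσ (Q * q)).2
    simp only [hL, Polynomial.eval_mul, hQ] at h1
    have h2 : v (-D) = 0 := by simp [v]
    rw [hB'int, h1, h2, zero_mul, mul_zero, sub_zero]
    refine integral_congr_ae ?_
    filter_upwards [hD] with x hx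
    simp only [v, hwdef]
    field_simp
  have hprob : IsProbabilityMeasure B' := by
    have h1 := hB'e 1
    simp only [Polynomial.eval_one, integral_const, smul_eq_mul, mul_one] at h1
    rw [probReal_univ (μ := B), measureReal_def, ENNReal.toReal_eq_one_iff] at h1
    exact ⟨h1⟩
  have hBB : B' = B := hdet B' hprob hB'i hB'e
  have h1 : ∫ x, w x ^ 2 ∂B = ∫ x, v x * w x ^ 2 ∂σ := by
    rw [← hB'int, hBB]
  have h2 := hσ 1
  simp only [hL, Polynomial.eval_one, one_mul, mul_one] at h2
  -- The integrand is 1 off -D and 0 at -D, where the quotient takes its default value; σ may well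
  -- have an atom there.
  have h3 : ∫ x, v x * w x ^ 2 ∂σ ≤ ∫ x, (1 : ℝ) ∂σ := by
    refine integral_mono_of_nonneg (.of_forall fun x => mul_nonneg (hv0 x) (sq_nonneg _)) h2.1
      (.of_forall fun x => ?_)
    change (x + D) ^ 2 / C ^ 2 * (C / (x + D)) ^ 2 ≤ 1
    rw [div_pow, div_mul_div_comm, mul_comm]
    exact div_self_le_one _
  linarith

/-! ### Fourier coefficients and the main theorem -/

theorem prod_Icc_pred_succ (u : ℕ → ℕ → ℝ) (n : ℕ) :
    ∏ k ∈ Finset.Icc 1 (n + 1), u k (k - 1)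
      = (∏ k ∈ Finset.Icc 1 n, u k (k - 1)) * u (n + 1) n :=
  Finset.prod_Icc_succ_top (by omega) _

/-- The coefficient of `bPoly β γ n` in the expansion of `C / (x + D)`. -/
noncomputable def expansionCoeff (β γ : ℕ → ℝ) (C D : ℝ) (n : ℕ) : ℝ :=
  (-1) ^ n * ∏ k ∈ Finset.Icc 1 n, kappa β γ C D k / γ (k - 1)

theorem partialSum_eq_sum (β γ : ℕ → ℝ) (C D : ℝ) (N : ℕ) (x : ℝ) :
    partialSum β γ C D N x
      = ∑ n ∈ Finset.range (N + 1), expansionCoeff β γ C D n * (bPoly β γ n).eval x := by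
  rw [Finset.range_eq_Ico, Finset.sum_eq_sum_Ico_succ_bot (Nat.succ_pos N)]
  simp only [partialSum, expansionCoeff, bPoly]
  congr 1
  simp

theorem corollary1 (β γ : ℕ → ℝ) (C D : ℝ) (A B : Measure ℝ)
    [IsProbabilityMeasure A] [IsProbabilityMeasure B]
    (hB : IsMonicOrthogonal B (bPoly β γ))
    (hD : B {-D} = 0)
    (hpos : ∀ x ∈ B.support, x + D ≠ 0 → 0 ≤ C / (x + D))
    (hA : A = B.withDensity (fun x => ENNReal.ofReal (C / (x + D)))) :
    (∀ n, 1 ≤ n → kappa β γ C D n ≠ 0) ∧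
    IsMonicOrthogonal A (aPoly β γ C D) ∧
    (∀ n, bPoly β γ n = aPoly β γ C D n
      + ∑ j ∈ Finset.Icc 1 n,
          Polynomial.C ((-1) ^ j * ∏ k ∈ Finset.Icc (n - j + 1) n, kappa β γ C D k)
            * aPoly β γ C D (n - j)) ∧
    ((∀ μ : Measure ℝ, IsProbabilityMeasure μ → IsMonicOrthogonal μ (bPoly β γ) → μ = B) →
      Integrable (fun x => 1 / (x + D) ^ 2) B →
      Tendsto (fun N => eLpNorm (fun x => C / (x + D) - partialSum β γ C D N x) 2 B)
        atTop (𝓝 0) ∧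
      HasSum (fun n => energy β γ C D n) (C ^ 2 * ∫ x, 1 / (x + D) ^ 2 ∂B) ∧
      (Summable (fun n : ℕ => energy β γ C D n * Real.log n ^ 2) →
        ∀ᵐ x ∂B, Tendsto (fun N => partialSum β γ C D N x) atTop (𝓝 (C / (x + D))))) := by
  have hDae : ∀ᵐ x ∂B, x + D ≠ 0 := by
    filter_upwards [compl_mem_ae_iff.2 hD] with x hx h
    exact hx (eq_neg_of_add_eq_zero_left h)
  have hw0 : ∀ᵐ x ∂B, 0 ≤ C / (x + D) := by
    filter_upwards [hDae, Measure.support_mem_ae (μ := B)] with x hx hs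
    exact hpos x hs hx
  have hC : C ≠ 0 := by
    rintro rfl
    refine IsProbabilityMeasure.ne_zero A ?_
    rw [hA]
    simp
  have hm : Measurable fun x : ℝ => ENNReal.ofReal (C / (x + D)) := by fun_prop
  have htop : ∀ᵐ x ∂B, ENNReal.ofReal (C / (x + D)) < ⊤ :=
    .of_forall fun x => ENNReal.ofReal_lt_top
  have hAint : ∀ g : ℝ → ℝ, ∫ x, g x ∂A = ∫ x, C / (x + D) * g x ∂B := by
    intro g
    rw [hA, integral_withDensity_eq_integral_toReal_smul hm htop]
    refine integral_congr_ae ?_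
    filter_upwards [hw0] with x hx
    rw [ENNReal.toReal_ofReal hx, smul_eq_mul]
  have hAi : ∀ g : ℝ → ℝ, Integrable g A ↔ Integrable (fun x => C / (x + D) * g x) B := by
    intro g
    rw [hA, integrable_withDensity_iff_integrable_smul' hm htop]
    refine integrable_congr ?_
    filter_upwards [hw0] with x hx
    rw [ENNReal.toReal_ofReal hx, smul_eq_mul]
  have hBmom := hB.integrable_eval
  have hcancel : ∀ r : Polynomial ℝ, (fun x => C * r.eval x) =ᵐ[B]
      fun x => C / (x + D) * ((Polynomial.X + Polynomial.C D) * r).eval x := by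
    intro r
    filter_upwards [hDae] with x hx
    simp only [Polynomial.eval_mul, Polynomial.eval_add, Polynomial.eval_X, Polynomial.eval_C]
    field_simp
  have hAmom : ∀ q : Polynomial ℝ, Integrable (fun x => q.eval x) A := by
    intro q
    obtain ⟨r, hr, -⟩ := Polynomial.exists_eq_X_add_C_mul_add_C D q
    have h1 : Integrable (fun x => ((Polynomial.X + Polynomial.C D) * r).eval x) A :=
      (hAi _).2 (((hBmom r).const_mul C).congr (hcancel r))
    rw [hr]
    simp only [Polynomial.eval_add (p := (Polynomial.X + Polynomial.C D) * r), Polynomial.eval_C]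
    exact h1.add (integrable_const _)
  have hwmom : ∀ q : Polynomial ℝ, Integrable (fun x => C / (x + D) * q.eval x) B :=
    fun q => (hAi _).1 (hAmom q)
  set LA := momentFunctional A hAmom with hLA
  set LB := momentFunctional B hBmom with hLB
  have hAB : ∀ r, LA ((Polynomial.X + Polynomial.C D) * r) = C * LB r := by
    intro r
    rw [hLA, hLB, momentFunctional_apply, momentFunctional_apply, hAint, ← integral_const_mul]
    exact integral_congr_ae (hcancel r).symm
  have hLA1 : LA 1 = 1 := by simp [hLA, momentFunctional_apply]
  have hLB1 : LB 1 = 1 := by simp [hLB, momentFunctional_apply]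
  have horth : ∀ m n, m ≠ n → LB (bPoly β γ m * bPoly β γ n) = 0 := by
    intro m n hmn
    rw [hLB, momentFunctional_mul]
    exact hB.orthogonal m n hmn
  have hLApos : ∀ q, q ≠ 0 → 0 < LA (q * q) := by
    intro q hq
    rw [hLA, momentFunctional_mul]
    -- If ∫ w q² dB = 0, then q = 0 B-almost everywhere because w ≠ 0 there, against ∫ q² dB > 0.
    refine lt_of_le_of_ne (integral_nonneg fun x => mul_self_nonneg _) fun h0 => ?_
    have h1 := hAmom (q * q)
    simp only [Polynomial.eval_mul] at h1
    rw [hAint, eq_comm, integral_eq_zero_iff_of_nonneg_ae _ ((hAi _).1 h1)] at h0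
    · refine (hB.integral_sq_pos hq).ne' (integral_eq_zero_of_ae ?_)
      filter_upwards [h0, hDae] with x hx hxD
      have := (mul_eq_zero.1 hx).resolve_left (div_ne_zero hC hxD)
      simpa [sq] using this
    · filter_upwards [hw0] with x hx
      exact mul_nonneg hx (mul_self_nonneg _)
  have hmon := hB.monic
  have hdeg := hB.natDegree_eq
  have hne := functional_bPoly_ne_zero hmon hdeg horth hLApos hAB
  have hsucc := functional_bPoly_succ hmon hdeg horth hLApos hAB hLA1 hLB1
  have hamd := aPoly_monic_natDegree hmon hdeg C D
  have ha0 : ∀ m n, m < n → LA (aPoly β γ C D n * aPoly β γ C D m) = 0 := by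
    intro m n hmn
    refine functional_aPoly_mul_eq_zero hmon hdeg horth hLApos hAB hLA1 hLB1 ?_
    rw [Polynomial.degree_eq_natDegree (hamd m).1.ne_zero, (hamd m).2]
    exact_mod_cast hmn
  refine ⟨fun n hn hκ => ?_, ⟨fun n => (hamd n).1, fun n => (hamd n).2, fun m n => ?_,
    fun m n hmn => ?_, fun n => ?_⟩, bPoly_eq_sum_aPoly β γ C D, fun huniq hint => ?_⟩
  · obtain ⟨k, rfl⟩ := Nat.exists_eq_add_of_le' hn
    refine hne (k + 1) ?_
    rw [hsucc, hκ, neg_zero, zero_mul]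
  · simpa using hAmom (aPoly β γ C D m * aPoly β γ C D n)
  · rw [← momentFunctional_mul hAmom]
    rcases hmn.lt_or_gt with h | h
    · rw [mul_comm]
      exact ha0 m n h
    · exact ha0 n m h
  · simp only [sq]
    rw [← momentFunctional_mul hAmom]
    exact hLApos _ (hamd n).1.ne_zero
  have hsq : ∀ x, (C / (x + D)) ^ 2 = C ^ 2 * (1 / (x + D) ^ 2) := by
    intro x
    rw [div_pow, mul_one_div]
  have hw2 : Integrable (fun x => (C / (x + D)) ^ 2) B := by
    simp only [hsq]
    exact hint.const_mul _
  have hE : C ^ 2 * ∫ x, 1 / (x + D) ^ 2 ∂B = ∫ x, (C / (x + D)) ^ 2 ∂B := by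
    simp only [hsq]
    rw [integral_const_mul]
  rw [hE]
  set h : ℕ → ℝ := fun n => ∫ x, (bPoly β γ n).eval x ^ 2 ∂B with hh
  set m : ℕ → ℝ := fun n => ∫ x, C / (x + D) * (bPoly β γ n).eval x ∂B with hmdef
  have hh0 : ∀ n, 0 < h n := hB.norm_pos
  have hLBh : ∀ n, LB (bPoly β γ n * bPoly β γ n) = h n := by
    intro n
    rw [hLB, momentFunctional_mul, hh]
    simp only [sq]
  have hhsucc : ∀ n, h (n + 1) = γ n * h n := by
    intro n
    rw [← hLBh, ← hLBh]
    exact bPoly_functional_sq_succ hmon hdeg horth n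
  have hγ : ∀ n, γ n ≠ 0 := by
    intro n h0
    have := hh0 (n + 1)
    rw [hhsucc, h0, zero_mul] at this
    exact this.false
  have hLAm : ∀ n, LA (bPoly β γ n) = m n := by
    intro n
    rw [hLA, momentFunctional_apply, hAint]
  have hmsucc : ∀ n, m (n + 1) = -kappa β γ C D (n + 1) * m n := by
    intro n
    rw [← hLAm, ← hLAm]
    exact hsucc n
  have hm0 : m 0 = 1 := by
    rw [← hLAm]
    exact hLA1
  have hh00 : h 0 = 1 := by
    rw [← hLBh]
    simpa [bPoly] using hLB1
  -- The coefficients of the series are the Fourier coefficients m_n / h_n of w.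
  have hcoeff : ∀ n, expansionCoeff β γ C D n * h n = m n := by
    intro n
    induction n with
    | zero => simp [expansionCoeff, hh00, hm0]
    | succ n ih =>
      rw [hhsucc, hmsucc, ← ih]
      simp only [expansionCoeff]
      rw [prod_Icc_pred_succ (fun i j => kappa β γ C D i / γ j)]
      have := hγ n
      field_simp
      ring
  have henergy : ∀ n, energy β γ C D n = expansionCoeff β γ C D n ^ 2 * h n := by
    intro n
    induction n with
    | zero => simp [energy, expansionCoeff, hh00]
    | succ n ih =>
      rw [hhsucc]
      simp only [energy, expansionCoeff] at ih ⊢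
      rw [prod_Icc_pred_succ (fun i j => kappa β γ C D i ^ 2 / γ j), ih,
        prod_Icc_pred_succ (fun i j => kappa β γ C D i / γ j)]
      have := hγ n
      field_simp
      ring
  have hfp : ∀ n, Integrable (fun x => C / (x + D) * (bPoly β γ n).eval x) B := fun n => hwmom _
  have hpars := fun N => hB.integral_sub_sum_sq hw2 hfp (expansionCoeff β γ C D) N
  have hdist : ∀ N, ∫ x, (C / (x + D) - ∑ n ∈ Finset.range N,
      expansionCoeff β γ C D n * (bPoly β γ n).eval x) ^ 2 ∂B
      = ∫ x, (C / (x + D)) ^ 2 ∂B - ∑ n ∈ Finset.range N, energy β γ C D n := by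
    intro N
    rw [(hpars N).2, sub_eq_add_neg, ← Finset.sum_neg_distrib]
    congr 1
    refine Finset.sum_congr rfl fun n _ => ?_
    change expansionCoeff β γ C D n ^ 2 * h n - 2 * expansionCoeff β γ C D n * m n = _
    rw [henergy, ← hcoeff]
    ring
  have henergy0 : ∀ n, 0 ≤ energy β γ C D n := by
    intro n
    rw [henergy]
    exact mul_nonneg (sq_nonneg _) (hh0 n).le
  have hmono : Monotone fun N => ∑ n ∈ Finset.range N, energy β γ C D n :=
    monotone_nat_of_le_succ fun N => by
      rw [Finset.sum_range_succ]
      exact le_add_of_nonneg_right (henergy0 N)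
  have hsum : HasSum (fun n => energy β γ C D n) (∫ x, (C / (x + D)) ^ 2 ∂B) := by
    rw [hasSum_iff_tendsto_nat_of_nonneg henergy0]
    refine tendsto_order.2 ⟨fun a ha => ?_, fun a ha => .of_forall fun N => ?_⟩
    · obtain ⟨q, hq⟩ := exists_polynomial_integral_sub_sq_lt hC hDae hwmom hw2
        (fun μ hμ h1 h2 => huniq μ hμ (hB.congr_moments h1 h2)) (sub_pos.2 ha)
      obtain ⟨N, c, rfl⟩ := hB.exists_eq_sum q
      simp only [Polynomial.eval_finsetSum, Polynomial.eval_mul, Polynomial.eval_C] at hq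
      rw [(hB.integral_sub_sum_sq hw2 hfp c N).2] at hq
      filter_upwards [eventually_ge_atTop N] with M hM
      refine lt_of_lt_of_le ?_ (hmono hM)
      -- Fourier coefficients give the best approximation: completing the square leaves (c_n -
      -- m_n/h_n)² h_n ≥ 0.
      have hle : -∑ n ∈ Finset.range N, energy β γ C D n
          ≤ ∑ n ∈ Finset.range N, (c n ^ 2 * h n - 2 * c n * m n) := by
        rw [← Finset.sum_neg_distrib]
        refine Finset.sum_le_sum fun n _ => ?_
        rw [henergy, ← hcoeff]
        nlinarith [mul_nonneg (sq_nonneg (c n - expansionCoeff β γ C D n)) (hh0 n).le]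
      change _ + ∑ n ∈ Finset.range N, (c n ^ 2 * h n - 2 * c n * m n) < _ at hq
      beta_reduce
      linarith
    · refine lt_of_le_of_lt ?_ ha
      rw [← sub_nonneg, ← hdist]
      exact integral_nonneg fun x => sq_nonneg _
  refine ⟨?_, hsum, fun hlog => ?_⟩
  · have hlim : Tendsto (fun N => ∫ x, (C / (x + D) - partialSum β γ C D N x) ^ 2 ∂B)
        atTop (𝓝 0) := by
      simp only [partialSum_eq_sum, hdist]
      rw [← sub_self (∫ x, (C / (x + D)) ^ 2 ∂B)]
      -- `partialSum` at N includes the terms 0, …, N, hence the shift by one.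
      exact tendsto_const_nhds.sub (hsum.tendsto_sum_nat.comp (tendsto_add_atTop_nat 1))
    have hmeas : ∀ N, AEStronglyMeasurable (fun x => C / (x + D) - partialSum β γ C D N x) B := by
      intro N
      refine Measurable.aestronglyMeasurable ?_
      simp only [partialSum_eq_sum]
      refine Measurable.sub (by fun_prop) (Finset.measurable_fun_sum _ fun n _ => ?_)
      exact (bPoly β γ n).continuous.measurable.const_mul _
    have hLp : ∀ N, MemLp (fun x => C / (x + D) - partialSum β γ C D N x) 2 B := by
      intro N
      rw [memLp_two_iff_integrable_sq (hmeas N)]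
      simp only [partialSum_eq_sum]
      exact (hpars (N + 1)).1
    have heq : ∀ N, eLpNorm (fun x => C / (x + D) - partialSum β γ C D N x) 2 B
        = ENNReal.ofReal
          (Real.sqrt (∫ x, (C / (x + D) - partialSum β γ C D N x) ^ 2 ∂B)) := by
      intro N
      rw [(hLp N).eLpNorm_eq_integral_rpow_norm two_ne_zero ENNReal.ofNat_ne_top,
        Real.sqrt_eq_rpow]
      simp
    simp only [heq]
    have := ENNReal.tendsto_ofReal hlim.sqrt
    simpa using this
  · have hφ2 : ∀ n, ∫ x, (expansionCoeff β γ C D n * (bPoly β γ n).eval x) ^ 2 ∂B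
        = energy β γ C D n := by
      intro n
      simp only [mul_pow, integral_const_mul]
      exact (henergy n).symm
    have hφe : ∀ i j, (fun x => expansionCoeff β γ C D i * (bPoly β γ i).eval x
          * (expansionCoeff β γ C D j * (bPoly β γ j).eval x))
        = fun x => expansionCoeff β γ C D i * expansionCoeff β γ C D j
          * ((bPoly β γ i).eval x * (bPoly β γ j).eval x) := by
      intro i j
      ext x
      ring
    have := rademacher_menshov (μ := B) (f := fun x => C / (x + D))
      (φ := fun n x => expansionCoeff β γ C D n * (bPoly β γ n).eval x)
      (fun i j => by
        rw [hφe]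
        exact (hB.integrable i j).const_mul _)
      (fun i j hij => by
        rw [hφe, integral_const_mul, hB.orthogonal i j hij, mul_zero])
      (fun N => (hpars N).1) (by simpa only [hφ2] using hsum)
      (fun N => by simpa only [hφ2] using hdist N) (by simpa only [hφ2] using hlog)
    filter_upwards [this] with x hx
    simp only [partialSum_eq_sum]
    exact hx.comp (tendsto_add_atTop_nat 1)
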